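/- Let $n\ge 1$ and $d\ge 0$ be integers. Let $R_n>0$ be the radius of the isotropic Euclidean ball in $\mathbb R^n$, i.e. the uniform probability measure $\mu$ on $\{x\in\mathbb R^n:\|x\|_2\le R_n\}$ is centered and has identity covariance matrix. For multi-indices $I,J\in\mathbb N^n$ with $|I|=|J|=d$ put $$\widetilde C_{I,J}=\frac{\mathbb E_\mu[x^{I+J}]-\mathbb E_\mu[x^I]\,\mathbb E_\mu[x^J]}{I!},\qquad I!=I_1!\cdots I_n!,$$ and let the matrix $\widetilde C=(\widetilde C_{I,J})$ act on the space $\mathcal P_d(\mathbb R^n)$ of real homogeneous polynomials of degree $d$ in the basis of monomials: $\widetilde C\big(\sum_J a_Jx^J\big)=\sum_I\big(\sum_J \widetilde C_{I,J}a_J\big)x^I$. Let $\mathcal H_m(\mathbb R^n)$ be the space of harmonic homogeneous polynomials of degree $m$. For integers $0\le i\le d/2$ let $$\eta_i=R_n^{2d}\,\frac{n}{n+2d}\cdot\frac{1}{2^i\,i!\;n(n+2)\cdots(n+2d-2i-2)}\quad\text{if } i<\tfrac d2,$$ and, if $d$ is even, $$\eta_{d/2}=R_n^{2d}\,\frac{d^2}{2^{d/2}\,(d/2)!\,(n+2d)(n+d)\prod_{j=0}^{d/2-1}(d+n-2j)}.$$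 Then, for every integer $0\le i\le d/2$, the subspace $\|x\|^{2i}\mathcal H_{d-2i}(\mathbb R^n)$ of $\mathcal P_d(\mathbb R^n)$ is exactly the eigenspace $\{f\in\mathcal P_d(\mathbb R^n):\widetilde Cf=\eta_i f\}$. In particular the multiplicity of $\eta_i$ (both the dimension of this eigenspace and the multiplicity of $\eta_i$ as a root of the characteristic polynomial of $\widetilde C$) equals $$\dim\mathcal H_{d-2i}(\mathbb R^n)=\binom{n+d-2i-1}{n-1}-\binom{n+d-2i-3}{n-1},$$ where $\binom ak=0$ for $a<0$. (For $n=1$ and $d-2i\ge 2$ this space is zero, and the statement says that $\eta_i$ is not an eigenvalue.) -/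

import Mathlib

open scoped Nat

noncomputable section

namespace BallCovariance

open MeasureTheory ProbabilityTheory MvPolynomial

/-- The uniform probability measure on the closed Euclidean ball of radius `R` about the origin
of `ℝⁿ`. -/
def uniformBall (n : ℕ) (R : ℝ) : Measure (EuclideanSpace ℝ (Fin n)) :=
  ProbabilityTheory.cond volume (Metric.closedBall 0 R)

/-- A probability measure on `ℝⁿ` is isotropic if it is centered and its covariance matrix is
the identity. -/
structure IsIsotropic {n : ℕ} (μ : Measure (EuclideanSpace ℝ (Fin n))) : Prop where
  isProbabilityMeasure : IsProbabilityMeasure μ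
  centered : ∀ i, ∫ x, x i ∂μ = 0
  covariance_eq : ∀ i j,
    covariance (fun x : EuclideanSpace ℝ (Fin n) => x i) (fun x => x j) μ = if i = j then 1 else 0

/-- The multi-indices `I ∈ ℕⁿ` with `|I| = d`. -/
abbrev MultiIndex (n d : ℕ) : Type := {I : Fin n →₀ ℕ // I.degree = d}

instance (n d : ℕ) : Fintype (MultiIndex n d) :=
  Fintype.subtype (Finset.finsuppAntidiag (Finset.univ : Finset (Fin n)) d) fun I => by
    simp [Finset.mem_finsuppAntidiag, Finsupp.degree_eq_sum]

/-- The monomial function `x ↦ x^I` on `ℝⁿ`. -/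
def monomialFun {n : ℕ} (I : Fin n →₀ ℕ) (x : EuclideanSpace ℝ (Fin n)) : ℝ :=
  ∏ k, x k ^ I k

/-- The multi-index factorial `I! = I₁! ⋯ Iₙ!`. -/
def multiFactorial {n : ℕ} (I : Fin n →₀ ℕ) : ℕ := ∏ k, (I k)!

/-- The matrix of `Cov(X^{⊗d})`, `X ∼ μ`, in the monomial basis:
`C_{I,J} = E[x^{I+J}] - E[x^I] E[x^J]`. -/
def covMatrix {n : ℕ} (μ : Measure (EuclideanSpace ℝ (Fin n))) (d : ℕ) :
    Matrix (MultiIndex n d) (MultiIndex n d) ℝ := fun I J =>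
  (∫ x, monomialFun (I.1 + J.1) x ∂μ) - (∫ x, monomialFun I.1 x ∂μ) * ∫ x, monomialFun J.1 x ∂μ

/-- The Bombieri-normalized covariance matrix `C̃_{I,J} = C_{I,J} / I!`. -/
def covMatrixTilde {n : ℕ} (μ : Measure (EuclideanSpace ℝ (Fin n))) (d : ℕ) :
    Matrix (MultiIndex n d) (MultiIndex n d) ℝ := fun I J =>
  covMatrix μ d I J / (multiFactorial I.1 : ℝ)

/-- The operator of a matrix `M` on the space `𝒫_d(ℝⁿ)` of homogeneous polynomials of degree `d`,
in the basis of monomials: `∑_J a_J x^J ↦ ∑_I (∑_J M_{I,J} a_J) x^I`. -/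
def matrixOperator {n d : ℕ} (M : Matrix (MultiIndex n d) (MultiIndex n d) ℝ) :
    Module.End ℝ (homogeneousSubmodule (Fin n) ℝ d) where
  toFun f := ⟨∑ I : MultiIndex n d, monomial I.1 (∑ J : MultiIndex n d, M I J * coeff J.1 f.1),
    Submodule.sum_mem _ fun I _ => isHomogeneous_monomial _ I.2⟩
  map_add' f g := by
    ext1
    simp [mul_add, Finset.sum_add_distrib]
  map_smul' c f := by
    ext1
    simp only [Submodule.coe_smul, coeff_smul, smul_eq_mul, RingHom.id_apply, Finset.smul_sum,
      smul_monomial, Finset.mul_sum]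
    simp only [mul_left_comm]

/-- The Laplacian on polynomials. -/
def laplacian (n : ℕ) : MvPolynomial (Fin n) ℝ →ₗ[ℝ] MvPolynomial (Fin n) ℝ :=
  ∑ k : Fin n, (pderiv k).toLinearMap ∘ₗ (pderiv k).toLinearMap

/-- `ℋ_m(ℝⁿ)`: the harmonic homogeneous polynomials of degree `m`. -/
def harmonicSubmodule (n m : ℕ) : Submodule ℝ (MvPolynomial (Fin n) ℝ) :=
  homogeneousSubmodule (Fin n) ℝ m ⊓ LinearMap.ker (laplacian n)

/-- The polynomial `‖x‖² = x₁² + ⋯ + xₙ²`. -/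
def normSqPoly (n : ℕ) : MvPolynomial (Fin n) ℝ := ∑ k : Fin n, X k ^ 2

/-- The subspace `‖x‖^{2i} ℋ_{d-2i}(ℝⁿ)`, meant for `2 i ≤ d`. -/
def normHarmonic (n d i : ℕ) : Submodule ℝ (MvPolynomial (Fin n) ℝ) :=
  (harmonicSubmodule n (d - 2 * i)).map (LinearMap.mulLeft ℝ (normSqPoly n ^ i))

/-- The number `η_i`, meant for `2 i ≤ d`; the second case is that of `d` even, `i = d / 2`. -/
def eta (n d : ℕ) (R : ℝ) (i : ℕ) : ℝ :=
  if 2 * i < d then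
    R ^ (2 * d) * ((n : ℝ) / (n + 2 * d)) *
      (1 / (2 ^ i * (i ! : ℝ) * ∏ j ∈ Finset.range (d - i), ((n : ℝ) + 2 * j)))
  else
    R ^ (2 * d) * ((d : ℝ) ^ 2 /
      (2 ^ (d / 2) * ((d / 2)! : ℝ) * ((n : ℝ) + 2 * d) * ((n : ℝ) + d) *
        ∏ j ∈ Finset.range (d / 2), ((d : ℝ) + n - 2 * j)))

/-- The binomial coefficient `a` over `k`, with the convention that it is `0` for `a < 0`. -/
def binom (a : ℤ) (k : ℕ) : ℤ := if 0 ≤ a then (a.toNat.choose k : ℤ) else 0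

end BallCovariance

end

/-! In polar coordinates the integral of `x^K` against a radial density is a sphere integral times a
radial one. Comparing the ball with the Gaussian, each moment of degree `D` of the ball is
`ballConst n R D` times the Gaussian moment. Everything thus reduces to the Gaussian expectation
`E`, for which `E[x_k p] = E[∂_k p]`.

This rule and `Δh = 0` give `E[x^I h] = I! [x^I](‖x‖^{2i} h) / (2^i i!)` for `h` harmonic of degree
`m` and `|I| = m + 2i` (`gaussFunctional_monomial_mul_harmonic`), and an extra factor `‖x‖^{2i}`
under `E` only contributes an explicit product. After division by `I!` the coefficient of `f =
‖x‖^{2i} h` remains, so `E[x^I f]` acts as a scalar. The rank-one term `E[x^I] E[f]` vanishes unless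
`2i = d`; then `f` is a multiple of `‖x‖^d` and the term only changes the scalar.

The spaces `‖x‖^{2i} ℋ_{d-2i}` span `𝒫_d` (`homogeneousSubmodule_le_iSup_normHarmonic`) and the
`η_i` are distinct (`eta_injective`). Eigenspaces being independent, spanning subspaces inside them
must fill them. The operator is then semisimple, so algebraic and geometric multiplicities agree;
rank-nullity for the surjective Laplacian gives the dimension. -/

namespace BallCovariance

open MeasureTheory ProbabilityTheory MvPolynomial

/-! ### Gaussian moments -/

/-- The moments of the standard Gaussian law on `ℝ`. -/
noncomputable def gaussMoment : ℕ → ℝ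
  | 0 => 1
  | 1 => 0
  | m + 2 => (m + 1) * gaussMoment m

/-- The moments of the standard Gaussian law on `ℝⁿ`. -/
noncomputable def gaussWeight {n : ℕ} (K : Fin n →₀ ℕ) : ℝ := ∏ k, gaussMoment (K k)

lemma gaussMoment_odd (s : ℕ) : gaussMoment (2 * s + 1) = 0 := by
  induction s with
  | zero => rfl
  | succ s ih =>
    rw [show 2 * (s + 1) + 1 = (2 * s + 1) + 2 by ring, gaussMoment, ih, mul_zero]

lemma gaussWeight_of_odd_degree {n : ℕ} {K : Fin n →₀ ℕ} (hK : Odd K.degree) :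
    gaussWeight K = 0 := by
  rw [Finsupp.degree_eq_sum] at hK
  obtain ⟨k, hk⟩ : ∃ k, Odd (K k) := by
    by_contra! h
    exact (Nat.not_even_iff_odd.mpr hK)
      (Finset.even_sum _ fun k _ => Nat.not_odd_iff_even.mp (h k))
  obtain ⟨s, hs⟩ := hk
  exact Finset.prod_eq_zero (Finset.mem_univ k) (by rw [hs, gaussMoment_odd])

lemma integrable_pow_mul_exp_neg_sq_half (m : ℕ) :
    Integrable fun x : ℝ => x ^ m * Real.exp (-(x ^ 2) / 2) := by
  have h := integrable_rpow_mul_exp_neg_mul_sq (b := 1 / 2) (by norm_num) (s := m)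
    (by linarith [(Nat.cast_nonneg m : (0 : ℝ) ≤ m)])
  refine h.congr (.of_forall fun x => ?_)
  simp only [Real.rpow_natCast]
  ring_nf

lemma hasDerivAt_exp_neg_sq_half (x : ℝ) :
    HasDerivAt (fun x : ℝ => Real.exp (-(x ^ 2) / 2)) (-x * Real.exp (-(x ^ 2) / 2)) x := by
  have h : HasDerivAt (fun x : ℝ => -(x ^ 2) / 2) (-x) x := by
    convert! ((hasDerivAt_pow 2 x).neg.div_const 2) using 1
    norm_num
    ring
  convert! h.exp using 1
  ring

lemma integral_pow_mul_exp_neg_sq_half (m : ℕ) :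
    ∫ x : ℝ, x ^ m * Real.exp (-(x ^ 2) / 2) =
      gaussMoment m * ∫ x : ℝ, Real.exp (-(x ^ 2) / 2) := by
  induction m using Nat.twoStepInduction with
  | zero => simp [gaussMoment]
  | one =>
    -- With `u = 1`, integration by parts says that the integral of a derivative over the line is
    -- zero.
    have h := integral_mul_deriv_eq_deriv_mul_of_integrable (u := fun _ : ℝ => (1 : ℝ))
      (u' := fun _ => 0) (v := fun x : ℝ => Real.exp (-(x ^ 2) / 2))
      (v' := fun x => -x * Real.exp (-(x ^ 2) / 2))
      (fun x _ => hasDerivAt_const x 1) (fun x _ => hasDerivAt_exp_neg_sq_half x)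
      (by
        refine (integrable_pow_mul_exp_neg_sq_half 1).neg.congr (.of_forall fun x => ?_)
        simp)
      (by simp [Pi.mul_def])
      (by
        refine (integrable_pow_mul_exp_neg_sq_half 0).congr (.of_forall fun x => ?_)
        simp)
    simp only [one_mul, zero_mul, integral_zero, neg_zero, neg_mul, integral_neg,
      neg_eq_zero] at h
    simpa [gaussMoment] using h
  | more m ih _ =>
    have h := integral_mul_deriv_eq_deriv_mul_of_integrable (u := fun x : ℝ => x ^ (m + 1))
      (u' := fun x => ((m + 1 : ℕ) : ℝ) * x ^ m) (v := fun x : ℝ => Real.exp (-(x ^ 2) / 2))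
      (v' := fun x => -x * Real.exp (-(x ^ 2) / 2))
      (fun x _ => by simpa using hasDerivAt_pow (m + 1) x)
      (fun x _ => hasDerivAt_exp_neg_sq_half x)
      (by
        refine (integrable_pow_mul_exp_neg_sq_half (m + 2)).neg.congr (.of_forall fun x => ?_)
        simp only [Pi.neg_apply, Pi.mul_apply]
        ring)
      (by
        refine ((integrable_pow_mul_exp_neg_sq_half m).const_mul ((m + 1 : ℕ) : ℝ)).congr
          (.of_forall fun x => ?_)
        simp only [Pi.mul_apply]
        ring)
      (integrable_pow_mul_exp_neg_sq_half (m + 1))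
    have h1 : (fun x : ℝ => x ^ (m + 1) * (-x * Real.exp (-(x ^ 2) / 2))) =
        fun x => -(x ^ (m + 2) * Real.exp (-(x ^ 2) / 2)) := by
      ext x
      ring
    simp only [h1, integral_neg, mul_assoc, integral_const_mul, ih, neg_inj] at h
    rw [h, gaussMoment]
    push_cast
    ring

lemma integral_monomialFun_mul_exp {n : ℕ} (K : Fin n →₀ ℕ) :
    ∫ x : EuclideanSpace ℝ (Fin n), monomialFun K x * Real.exp (-(‖x‖ ^ 2) / 2) =
      gaussWeight K * (∫ x : ℝ, Real.exp (-(x ^ 2) / 2)) ^ n := by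
  have h : ∀ x : EuclideanSpace ℝ (Fin n), monomialFun K x * Real.exp (-(‖x‖ ^ 2) / 2) =
      ∏ k, ((WithLp.ofLp x k) ^ K k * Real.exp (-((WithLp.ofLp x k) ^ 2) / 2)) := by
    intro x
    rw [Finset.prod_mul_distrib, ← Real.exp_sum, ← Finset.sum_div, Finset.sum_neg_distrib,
      EuclideanSpace.real_norm_sq_eq]
    rfl
  simp_rw [h]
  rw [(PiLp.volume_preserving_ofLp (Fin n)).integral_comp
      (MeasurableEquiv.toLp 2 (Fin n → ℝ)).symm.measurableEmbedding
      (fun y : Fin n → ℝ => ∏ k, ((y k) ^ K k * Real.exp (-((y k) ^ 2) / 2))),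
    integral_fintype_prod_volume_eq_prod (fun k (t : ℝ) => t ^ K k * Real.exp (-(t ^ 2) / 2))]
  simp_rw [integral_pow_mul_exp_neg_sq_half]
  rw [Finset.prod_mul_distrib, gaussWeight]
  simp

/-! ### Polar coordinates and the moments of the ball -/

lemma monomialFun_smul {n : ℕ} (K : Fin n →₀ ℕ) (r : ℝ) (x : EuclideanSpace ℝ (Fin n)) :
    monomialFun K (r • x) = r ^ K.degree * monomialFun K x := by
  simp [monomialFun, mul_pow, Finset.prod_mul_distrib, Finset.prod_pow_eq_pow_sum,
    Finsupp.degree_eq_sum]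

/-- Polar coordinates plus homogeneity of `x^K`. The sphere integral does not depend on `f`, so it
can be found with a Gaussian `f` and reused with the indicator of a ball. -/
lemma integral_monomialFun_mul_radial {n : ℕ} (hn : 1 ≤ n) (K : Fin n →₀ ℕ) (f : ℝ → ℝ) :
    ∫ x : EuclideanSpace ℝ (Fin n), monomialFun K x * f ‖x‖ =
      (∫ ω, monomialFun K ω.1 ∂(volume : Measure (EuclideanSpace ℝ (Fin n))).toSphere) *
        ∫ r in Set.Ioi (0 : ℝ), r ^ (n - 1 + K.degree) * f r := by
  have : Nonempty (Fin n) := ⟨⟨0, hn⟩⟩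
  set μ := (volume : Measure (EuclideanSpace ℝ (Fin n)))
  have hdim : Module.finrank ℝ (EuclideanSpace ℝ (Fin n)) = n := by simp
  calc
    ∫ x, monomialFun K x * f ‖x‖ ∂μ
      = ∫ x : ({0}ᶜ : Set (EuclideanSpace ℝ (Fin n))),
          monomialFun K x.1 * f ‖x.1‖ ∂(μ.comap (↑)) := by
      rw [integral_subtype_comap (measurableSet_singleton _).compl
        fun x => monomialFun K x * f ‖x‖, restrict_compl_singleton]
    _ = ∫ z, monomialFun K z.1.1 * (z.2.1 ^ K.degree * f z.2.1)
          ∂μ.toSphere.prod (.volumeIoiPow (n - 1)) := by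
      have := μ.measurePreserving_homeomorphUnitSphereProd.integral_comp
        (Homeomorph.measurableEmbedding _)
        (fun z => monomialFun K z.1.1 * (z.2.1 ^ K.degree * f z.2.1))
      rw [hdim] at this
      rw [← this]
      refine integral_congr_ae (.of_forall fun x => ?_)
      have hx : ‖x.1‖ ≠ 0 := norm_ne_zero_iff.mpr x.2
      simp only [homeomorphUnitSphereProd_apply_fst_coe, homeomorphUnitSphereProd_apply_snd_coe,
        monomialFun_smul]
      rw [inv_pow]
      field_simp
    _ = (∫ ω, monomialFun K ω.1 ∂μ.toSphere) *
          ∫ r : Set.Ioi (0 : ℝ), r.1 ^ K.degree * f r.1 ∂.volumeIoiPow (n - 1) :=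
      integral_prod_mul (L := ℝ) (fun ω : Metric.sphere (0 : EuclideanSpace ℝ (Fin n)) 1 =>
        monomialFun K ω.1) (fun r : Set.Ioi (0 : ℝ) => r.1 ^ K.degree * f r.1)
    _ = _ := by
      congr 1
      simp only [Measure.volumeIoiPow, ENNReal.ofReal]
      rw [integral_withDensity_eq_integral_smul,
        integral_subtype_comap measurableSet_Ioi
          fun a : ℝ => Real.toNNReal (a ^ (n - 1)) • (a ^ K.degree * f a),
        setIntegral_congr_fun measurableSet_Ioi fun x hx => ?_]
      · rw [NNReal.smul_def, Real.coe_toNNReal _ (pow_nonneg hx.out.le _), smul_eq_mul, pow_add]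
        ring
      · exact (measurable_subtype_coe.pow_const _).real_toNNReal

lemma integral_Ioi_pow_mul_exp (q : ℕ) :
    ∫ r in Set.Ioi (0 : ℝ), r ^ q * Real.exp (-(r ^ 2) / 2) =
      (1 / 2 : ℝ) ^ (-((q : ℝ) + 1) / 2) * (1 / 2) * Real.Gamma (((q : ℝ) + 1) / 2) := by
  rw [← integral_rpow_mul_exp_neg_mul_rpow (p := 2) (q := q) (b := 1 / 2) (by norm_num)
    (by linarith [(Nat.cast_nonneg q : (0 : ℝ) ≤ q)]) (by norm_num)]
  refine setIntegral_congr_fun measurableSet_Ioi fun x _ => ?_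
  simp only [Real.rpow_natCast, Real.rpow_two]
  ring_nf

lemma integral_Ioi_pow_mul_exp_pos (q : ℕ) :
    0 < ∫ r in Set.Ioi (0 : ℝ), r ^ q * Real.exp (-(r ^ 2) / 2) := by
  rw [integral_Ioi_pow_mul_exp]
  have := Real.Gamma_pos_of_pos (s := ((q : ℝ) + 1) / 2) (by positivity)
  positivity

lemma integral_Ioi_pow_add_two_mul_exp (q : ℕ) :
    ∫ r in Set.Ioi (0 : ℝ), r ^ (q + 2) * Real.exp (-(r ^ 2) / 2) =
      (q + 1) * ∫ r in Set.Ioi (0 : ℝ), r ^ q * Real.exp (-(r ^ 2) / 2) := by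
  rw [integral_Ioi_pow_mul_exp, integral_Ioi_pow_mul_exp]
  push_cast
  rw [show ((q : ℝ) + 2 + 1) / 2 = ((q : ℝ) + 1) / 2 + 1 by ring,
    Real.Gamma_add_one (by positivity),
    show -((q : ℝ) + 2 + 1) / 2 = -((q : ℝ) + 1) / 2 - 1 by ring,
    Real.rpow_sub_one (by norm_num)]
  ring

lemma integral_Ioi_pow_add_even_mul_exp {n : ℕ} (hn : 1 ≤ n) (s : ℕ) :
    ∫ r in Set.Ioi (0 : ℝ), r ^ (n - 1 + 2 * s) * Real.exp (-(r ^ 2) / 2) =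
      (∏ j ∈ Finset.range s, ((n : ℝ) + 2 * j)) *
        ∫ r in Set.Ioi (0 : ℝ), r ^ (n - 1) * Real.exp (-(r ^ 2) / 2) := by
  induction s with
  | zero => simp
  | succ s ih =>
    rw [show n - 1 + 2 * (s + 1) = n - 1 + 2 * s + 2 by ring, integral_Ioi_pow_add_two_mul_exp,
      ih, Finset.prod_range_succ]
    push_cast [Nat.cast_sub hn]
    ring

lemma monomialFun_zero {n : ℕ} (x : EuclideanSpace ℝ (Fin n)) : monomialFun 0 x = 1 := by
  simp [monomialFun]

lemma gaussWeight_zero {n : ℕ} : gaussWeight (0 : Fin n →₀ ℕ) = 1 := by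
  simp [gaussWeight, gaussMoment]

/-- Divide the Gaussian integral of `x^K` by that of `1`, both in polar coordinates: the ratio of
radial integrals is the product in the denominator. In odd degree both sides vanish, so rounding in
`K.degree / 2` is harmless. -/
lemma integral_toSphere_monomialFun {n : ℕ} (hn : 1 ≤ n) (K : Fin n →₀ ℕ) :
    ∫ ω, monomialFun K ω.1 ∂(volume : Measure (EuclideanSpace ℝ (Fin n))).toSphere =
      gaussWeight K / (∏ j ∈ Finset.range (K.degree / 2), ((n : ℝ) + 2 * j)) *
        ∫ ω, monomialFun 0 ω.1 ∂(volume : Measure (EuclideanSpace ℝ (Fin n))).toSphere := by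
  have hK := integral_monomialFun_mul_radial hn K fun r => Real.exp (-(r ^ 2) / 2)
  have h0 := integral_monomialFun_mul_radial hn 0 fun r => Real.exp (-(r ^ 2) / 2)
  rw [integral_monomialFun_mul_exp] at hK h0
  rw [gaussWeight_zero, one_mul, map_zero, add_zero] at h0
  rw [h0] at hK
  have hn' : (0 : ℝ) < n := by exact_mod_cast hn
  have hP : (0 : ℝ) < ∏ j ∈ Finset.range (K.degree / 2), ((n : ℝ) + 2 * j) :=
    Finset.prod_pos fun j _ => by positivity
  rcases Nat.even_or_odd' K.degree with ⟨s, hs | hs⟩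
  · rw [hs, integral_Ioi_pow_add_even_mul_exp hn] at hK
    have hρ := integral_Ioi_pow_mul_exp_pos (n - 1)
    have h2 : K.degree / 2 = s := by omega
    rw [h2] at hP ⊢
    rw [← mul_assoc, ← mul_assoc] at hK
    have := mul_right_cancel₀ hρ.ne' hK
    field_simp
    linarith
  · have hw : gaussWeight K = 0 := gaussWeight_of_odd_degree (hs ▸ odd_two_mul_add_one s)
    rw [hw, zero_mul] at hK
    rw [hw, zero_div, zero_mul]
    exact (mul_eq_zero.mp hK.symm).resolve_right (integral_Ioi_pow_mul_exp_pos _).ne'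

lemma setIntegral_closedBall_monomialFun {n : ℕ} (hn : 1 ≤ n) (K : Fin n →₀ ℕ) {R : ℝ}
    (hR : 0 < R) :
    ∫ x in Metric.closedBall (0 : EuclideanSpace ℝ (Fin n)) R, monomialFun K x =
      (∫ ω, monomialFun K ω.1 ∂(volume : Measure (EuclideanSpace ℝ (Fin n))).toSphere) *
        (R ^ (n + K.degree) / (n + K.degree)) := by
  have h := integral_monomialFun_mul_radial hn K ((Set.Iic R).indicator 1)
  have h1 : ∀ x : EuclideanSpace ℝ (Fin n), monomialFun K x * (Set.Iic R).indicator 1 ‖x‖ =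
      (Metric.closedBall (0 : EuclideanSpace ℝ (Fin n)) R).indicator (monomialFun K) x := by
    intro x
    classical
    simp only [Set.indicator_apply, Set.mem_Iic, mem_closedBall_zero_iff, Pi.one_apply, mul_ite,
      mul_one, mul_zero]
  have h2 : ∀ r : ℝ, r ^ (n - 1 + K.degree) * (Set.Iic R).indicator 1 r =
      (Set.Iic R).indicator (fun r => r ^ (n - 1 + K.degree)) r := by
    intro x
    simp [Set.indicator_apply]
  simp_rw [h1, h2] at h
  rw [integral_indicator Metric.isClosed_closedBall.measurableSet,
    setIntegral_indicator measurableSet_Iic, Set.Ioi_inter_Iic,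
    ← intervalIntegral.integral_of_le hR.le, integral_pow] at h
  rw [h]
  have e : n - 1 + K.degree + 1 = n + K.degree := by omega
  rw [e]
  have e' : ((n - 1 + K.degree : ℕ) : ℝ) + 1 = n + K.degree := by exact_mod_cast e
  rw [e', zero_pow (by omega), sub_zero]

/-- The constant relating the moments of degree `D` of the ball to the Gaussian ones. -/
noncomputable def ballConst (n : ℕ) (R : ℝ) (D : ℕ) : ℝ :=
  R ^ D * (n / (n + D)) / ∏ j ∈ Finset.range (D / 2), ((n : ℝ) + 2 * j)

lemma integral_uniformBall_monomialFun {n : ℕ} (hn : 1 ≤ n) (K : Fin n →₀ ℕ) {R : ℝ}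
    (hR : 0 < R) :
    ∫ x, monomialFun K x ∂uniformBall n R = ballConst n R K.degree * gaussWeight K := by
  have hn' : (0 : ℝ) < n := by exact_mod_cast hn
  have hP : (0 : ℝ) < ∏ j ∈ Finset.range (K.degree / 2), ((n : ℝ) + 2 * j) :=
    Finset.prod_pos fun j _ => by positivity
  have hvol : 0 < (volume : Measure (EuclideanSpace ℝ (Fin n))).real (Metric.closedBall 0 R) :=
    ENNReal.toReal_pos (Metric.measure_closedBall_pos _ _ hR).ne' measure_closedBall_lt_top.ne
  have h0 := setIntegral_closedBall_monomialFun hn 0 hR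
  simp only [monomialFun_zero, integral_const, MeasurableSet.univ, measureReal_restrict_apply,
    Set.univ_inter, smul_eq_mul, mul_one, map_zero, add_zero, Nat.cast_zero] at h0
  have hS := integral_toSphere_monomialFun hn K
  simp only [monomialFun_zero, integral_const, smul_eq_mul, mul_one] at hS
  rw [uniformBall, ProbabilityTheory.cond, integral_smul_measure,
    setIntegral_closedBall_monomialFun hn K hR, hS, ENNReal.toReal_inv, smul_eq_mul,
    ← measureReal_def, h0, ballConst]
  rw [h0] at hvol
  have : (0 : ℝ) < (volume : Measure (EuclideanSpace ℝ (Fin n))).toSphere.real Set.univ :=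
    pos_of_mul_pos_left hvol (by positivity)
  rw [pow_add]
  field_simp

/-! ### The Laplacian, multiplication by `‖x‖²`, and harmonic polynomials -/

section Laplacian

variable {n : ℕ}

lemma pderiv_comm (j k : Fin n) (p : MvPolynomial (Fin n) ℝ) :
    pderiv j (pderiv k p) = pderiv k (pderiv j p) := by
  rcases eq_or_ne j k with rfl | hjk
  · rfl
  · ext m
    simp only [coeff_pderiv, Finsupp.add_apply, Finsupp.single_eq_of_ne hjk,
      Finsupp.single_eq_of_ne hjk.symm, add_zero, add_right_comm m (Finsupp.single j 1)]
    ring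

lemma laplacian_apply (p : MvPolynomial (Fin n) ℝ) :
    laplacian n p = ∑ k, pderiv k (pderiv k p) := by
  simp [laplacian]

lemma laplacian_isHomogeneous {p : MvPolynomial (Fin n) ℝ} {e : ℕ} (hp : p.IsHomogeneous e) :
    (laplacian n p).IsHomogeneous (e - 2) := by
  rw [laplacian_apply]
  exact IsHomogeneous.sum _ _ _ fun k _ => hp.pderiv.pderiv

lemma normSqPoly_isHomogeneous : (normSqPoly n).IsHomogeneous 2 :=
  IsHomogeneous.sum _ _ _ fun k _ => by simpa using (isHomogeneous_X ℝ k).pow 2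

lemma pderiv_normSqPoly (k : Fin n) : pderiv k (normSqPoly n) = 2 * X k := by
  classical
  simp [normSqPoly, pderiv_X, Pi.single_apply]

lemma pderiv_normSqPoly_mul (k : Fin n) (p : MvPolynomial (Fin n) ℝ) :
    pderiv k (normSqPoly n * p) = 2 * (X k * p) + normSqPoly n * pderiv k p := by
  rw [pderiv_mul, pderiv_normSqPoly, mul_assoc]

lemma pderiv_normSqPoly_pow_mul (k : Fin n) (i : ℕ) (p : MvPolynomial (Fin n) ℝ) :
    pderiv k (normSqPoly n ^ i * p) =
      C (2 * i : ℝ) * (X k * (normSqPoly n ^ (i - 1) * p)) + normSqPoly n ^ i * pderiv k p := by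
  rw [pderiv_mul, pderiv_pow, pderiv_normSqPoly]
  simp only [map_mul, map_natCast, map_ofNat]
  ring

/-- Leibniz rule; the cross terms add up to `4 ∑ x_k ∂_k q`, which Euler's identity evaluates. -/
lemma laplacian_normSqPoly_mul {q : MvPolynomial (Fin n) ℝ} {e : ℕ} (hq : q.IsHomogeneous e) :
    laplacian n (normSqPoly n * q) =
      (2 * n + 4 * e : ℝ) • q + normSqPoly n * laplacian n q := by
  have h : ∀ k : Fin n, pderiv k (pderiv k (normSqPoly n * q)) =
      2 * q + 4 * (X k * pderiv k q) + normSqPoly n * pderiv k (pderiv k q) := by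
    intro k
    have h2 : pderiv k (2 : MvPolynomial (Fin n) ℝ) = 0 := by
      rw [← map_ofNat C 2, pderiv_C]
    rw [pderiv_normSqPoly_mul, map_add, pderiv_normSqPoly_mul, pderiv_mul, pderiv_mul, h2,
      pderiv_X_self]
    ring
  rw [laplacian_apply, laplacian_apply, Finset.sum_congr rfl fun k _ => h k,
    Finset.sum_add_distrib, Finset.sum_add_distrib, ← Finset.mul_sum, ← Finset.mul_sum,
    ← Finset.mul_sum,
    hq.sum_X_mul_pderiv]
  simp only [Finset.sum_const, Finset.card_univ, Fintype.card_fin, nsmul_eq_mul, smul_eq_C_mul,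
    map_add, map_mul, map_natCast, map_ofNat]
  ring

lemma mem_harmonicSubmodule {m : ℕ} {h : MvPolynomial (Fin n) ℝ} :
    h ∈ harmonicSubmodule n m ↔ h.IsHomogeneous m ∧ laplacian n h = 0 := by
  simp [harmonicSubmodule]

lemma pderiv_mem_harmonicSubmodule {m : ℕ} {h : MvPolynomial (Fin n) ℝ}
    (hh : h ∈ harmonicSubmodule n m) (k : Fin n) : pderiv k h ∈ harmonicSubmodule n (m - 1) := by
  rw [mem_harmonicSubmodule] at hh ⊢
  refine ⟨hh.1.pderiv, ?_⟩
  rw [laplacian_apply]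
  simp_rw [pderiv_comm _ k]
  rw [← map_sum, ← laplacian_apply, hh.2, map_zero]

lemma pderiv_of_isHomogeneous_zero {h : MvPolynomial (Fin n) ℝ} (hh : h.IsHomogeneous 0)
    (k : Fin n) : pderiv k h = 0 := by
  rw [← totalDegree_zero_iff_isHomogeneous, totalDegree_eq_zero_iff_eq_C] at hh
  rw [hh, pderiv_C]

end Laplacian

/-! ### Gaussian expectations of polynomials -/

section GaussFunctional

variable {n : ℕ}

/-- Expectation of a polynomial under the standard Gaussian law on `ℝⁿ`. -/
noncomputable def gaussFunctional (n : ℕ) : MvPolynomial (Fin n) ℝ →ₗ[ℝ] ℝ :=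
  (basisMonomials (Fin n) ℝ).constr ℝ gaussWeight

lemma gaussFunctional_monomial (K : Fin n →₀ ℕ) (c : ℝ) :
    gaussFunctional n (monomial K c) = c * gaussWeight K := by
  have h : gaussFunctional n (monomial K 1) = gaussWeight K := by
    have := (basisMonomials (Fin n) ℝ).constr_basis ℝ gaussWeight K
    simpa [gaussFunctional] using this
  rw [← mul_one c, ← smul_eq_mul, ← smul_monomial, map_smul, h, smul_eq_mul, smul_eq_mul, mul_one]

lemma gaussMoment_succ (m : ℕ) : gaussMoment (m + 1) = m * gaussMoment (m - 1) := by
  cases m with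
  | zero => simp [gaussMoment]
  | succ m => simp [gaussMoment]

lemma gaussWeight_single_add (k : Fin n) (K : Fin n →₀ ℕ) :
    gaussWeight (Finsupp.single k 1 + K) = K k * gaussWeight (K - Finsupp.single k 1) := by
  rw [gaussWeight, gaussWeight, ← Finset.mul_prod_erase _ _ (Finset.mem_univ k),
    ← Finset.mul_prod_erase _ (fun j => gaussMoment ((K - Finsupp.single k 1 : Fin n →₀ ℕ) j))
      (Finset.mem_univ k), ← mul_assoc]
  congr 1
  · simp [add_comm 1, gaussMoment_succ]
  · refine Finset.prod_congr rfl fun j hj => ?_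
    have : k ≠ j := (Finset.ne_of_mem_erase hj).symm
    simp [Finsupp.single_eq_of_ne' this]

/-- Gaussian integration by parts, here a purely algebraic consequence of the recursion for
`gaussMoment`. -/
lemma gaussFunctional_X_mul (k : Fin n) (p : MvPolynomial (Fin n) ℝ) :
    gaussFunctional n (X k * p) = gaussFunctional n (pderiv k p) := by
  induction p using MvPolynomial.induction_on' with
  | monomial K c =>
    rw [X, monomial_mul, pderiv_monomial, gaussFunctional_monomial, gaussFunctional_monomial,
      gaussWeight_single_add, one_mul, mul_assoc]
  | add p q hp hq => rw [mul_add, map_add, map_add, map_add, hp, hq]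

lemma gaussFunctional_normSqPoly_mul {p : MvPolynomial (Fin n) ℝ} {D : ℕ}
    (hp : p.IsHomogeneous D) :
    gaussFunctional n (normSqPoly n * p) = (n + D) * gaussFunctional n p := by
  rw [normSqPoly, Finset.sum_mul, map_sum]
  have h : ∀ k : Fin n, gaussFunctional n (X k ^ 2 * p) =
      gaussFunctional n p + gaussFunctional n (X k * pderiv k p) := by
    intro k
    rw [pow_two, mul_assoc, gaussFunctional_X_mul, pderiv_mul, pderiv_X_self, one_mul, map_add]
  simp_rw [h]
  rw [Finset.sum_add_distrib, ← map_sum (gaussFunctional n) (fun k => X k * pderiv k p),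
    hp.sum_X_mul_pderiv, map_nsmul]
  simp [add_mul]

lemma gaussFunctional_normSqPoly_pow_mul {p : MvPolynomial (Fin n) ℝ} {D : ℕ}
    (hp : p.IsHomogeneous D) (i : ℕ) :
    gaussFunctional n (normSqPoly n ^ i * p) =
      (∏ j ∈ Finset.range i, ((n : ℝ) + D + 2 * j)) * gaussFunctional n p := by
  induction i with
  | zero => simp
  | succ i ih =>
    rw [pow_succ', mul_assoc,
      gaussFunctional_normSqPoly_mul ((normSqPoly_isHomogeneous.pow i).mul hp), ih,
      Finset.prod_range_succ]
    push_cast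
    ring

lemma exists_eq_add_single {I : Fin n →₀ ℕ} (hI : I ≠ 0) :
    ∃ (k : Fin n) (J : Fin n →₀ ℕ), I = Finsupp.single k 1 + J ∧ I.degree = J.degree + 1 := by
  obtain ⟨k, hk⟩ := Finsupp.ne_iff.mp hI
  have hI' : I = Finsupp.single k 1 + (I - Finsupp.single k 1) := by
    rw [add_tsub_cancel_of_le]
    rw [Finsupp.single_le_iff]
    exact Nat.one_le_iff_ne_zero.mpr hk
  refine ⟨k, _, hI', ?_⟩
  nth_rw 1 [hI']
  simp [add_comm]

lemma gaussFunctional_monomial_single_add_mul (k : Fin n) (J : Fin n →₀ ℕ)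
    (p : MvPolynomial (Fin n) ℝ) :
    gaussFunctional n (monomial (Finsupp.single k 1 + J) 1 * p) =
      J k * gaussFunctional n (monomial (J - Finsupp.single k 1) 1 * p) +
        gaussFunctional n (monomial J 1 * pderiv k p) := by
  have h : (monomial (Finsupp.single k 1 + J) 1 : MvPolynomial (Fin n) ℝ) = X k * monomial J 1 := by
    rw [X, monomial_mul, one_mul]
  have h' : (monomial (J - Finsupp.single k 1) (J k : ℝ) : MvPolynomial (Fin n) ℝ) =
      (J k : ℝ) • monomial (J - Finsupp.single k 1) 1 := by
    rw [smul_monomial, smul_eq_mul, mul_one]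
  rw [h, mul_assoc, gaussFunctional_X_mul, pderiv_mul, pderiv_monomial, one_mul, h',
    smul_mul_assoc, map_add, map_smul, smul_eq_mul]

/-- By Euler and integration by parts, `m E[h] = ∑ E[x_k ∂_k h] = E[Δh] = 0`. -/
lemma gaussFunctional_harmonic {m : ℕ} (hm : 0 < m) {h : MvPolynomial (Fin n) ℝ}
    (hh : h ∈ harmonicSubmodule n m) : gaussFunctional n h = 0 := by
  rw [mem_harmonicSubmodule] at hh
  have e := congrArg (gaussFunctional n) hh.1.sum_X_mul_pderiv
  rw [map_sum, map_nsmul] at e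
  simp_rw [gaussFunctional_X_mul] at e
  rw [← map_sum, ← laplacian_apply, hh.2, map_zero] at e
  simpa [hm.ne'] using e.symm

/-- Moving one variable of `x^I` by parts either lowers `I` by two or differentiates `h`.
Derivatives of `h` stay harmonic, and `|I| < m` persists. -/
lemma gaussFunctional_monomial_mul_harmonic_of_lt (N : ℕ) : ∀ (I : Fin n →₀ ℕ) (m : ℕ)
    (h : MvPolynomial (Fin n) ℝ), I.degree = N → N < m → h ∈ harmonicSubmodule n m →
      gaussFunctional n (monomial I 1 * h) = 0 := by
  induction N using Nat.strong_induction_on with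
  | _ N ih =>
    intro I m h hI hm hh
    by_cases hI0 : I = 0
    · subst hI0
      simpa using gaussFunctional_harmonic (by omega) hh
    obtain ⟨k, J, rfl, hJ⟩ := exists_eq_add_single hI0
    rw [gaussFunctional_monomial_single_add_mul,
      ih J.degree (by omega) J (m - 1) _ rfl (by omega) (pderiv_mem_harmonicSubmodule hh k)]
    have hle : (J - Finsupp.single k 1).degree ≤ J.degree :=
      Finsupp.degree_mono tsub_le_self
    rw [ih _ (by omega) (J - Finsupp.single k 1) m h rfl (by omega) hh]
    simp

lemma multiFactorial_single_add (k : Fin n) (J : Fin n →₀ ℕ) :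
    multiFactorial (Finsupp.single k 1 + J) = (J k + 1) * multiFactorial J := by
  rw [multiFactorial, multiFactorial, ← Finset.mul_prod_erase _ _ (Finset.mem_univ k),
    ← Finset.mul_prod_erase _ (fun j => (J j)!) (Finset.mem_univ k), ← mul_assoc]
  congr 1
  · simp [add_comm 1, Nat.factorial_succ]
  · refine Finset.prod_congr rfl fun j hj => ?_
    have : k ≠ j := (Finset.ne_of_mem_erase hj).symm
    simp [Finsupp.single_eq_of_ne' this]

lemma multiFactorial_pos (I : Fin n →₀ ℕ) : 0 < multiFactorial I :=
  Finset.prod_pos fun _ _ => Nat.factorial_pos _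

/-- Both sides obey the same recursion when `x_k` is split off from `x^I = x_k x^J`. On the right,
`I! [x^I] q = J! [x^J] ∂_k q` for `q = ‖x‖^{2i} h`, and the two terms of the product rule for `∂_k
q` match those of integration by parts. -/
lemma gaussFunctional_monomial_mul_harmonic (N : ℕ) : ∀ (I : Fin n →₀ ℕ) (m i : ℕ)
    (h : MvPolynomial (Fin n) ℝ), I.degree = N → N = m + 2 * i → h ∈ harmonicSubmodule n m →
      gaussFunctional n (monomial I 1 * h) =
        multiFactorial I * coeff I (normSqPoly n ^ i * h) / (2 ^ i * i !) := by
  induction N using Nat.strong_induction_on with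
  | _ N ih =>
    intro I m i h hI hm hh
    by_cases hI0 : I = 0
    · subst hI0
      obtain ⟨rfl, rfl⟩ : m = 0 ∧ i = 0 := by
        rw [map_zero] at hI
        omega
      have h0 := (mem_harmonicSubmodule.mp hh).1
      rw [← totalDegree_zero_iff_isHomogeneous, totalDegree_eq_zero_iff_eq_C] at h0
      rw [h0, monomial_zero', C_1, one_mul, ← monomial_zero', gaussFunctional_monomial,
        gaussWeight_zero]
      simp [multiFactorial]
    obtain ⟨k, J, rfl, hJ⟩ := exists_eq_add_single hI0
    have hfirst : (J k : ℝ) * gaussFunctional n (monomial (J - Finsupp.single k 1) 1 * h) =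
        multiFactorial J * coeff J (C (2 * i : ℝ) * (X k * (normSqPoly n ^ (i - 1) * h))) /
          (2 ^ i * i !) := by
      rw [coeff_C_mul, coeff_X_mul']
      by_cases hk : k ∈ J.support
      · rw [if_pos hk]
        rw [Finsupp.mem_support_iff] at hk
        have hJ' : J = Finsupp.single k 1 + (J - Finsupp.single k 1) := by
          rw [add_tsub_cancel_of_le]
          rw [Finsupp.single_le_iff]
          exact Nat.one_le_iff_ne_zero.mpr hk
        set L := J - Finsupp.single k 1 with hL
        have hdeg : J.degree = L.degree + 1 := by
          rw [hJ', map_add, Finsupp.degree_single, add_comm]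
        have hJk : J k = L k + 1 := by
          rw [hJ']
          simp [add_comm]
        rw [hJk, hJ', multiFactorial_single_add]
        cases i with
        -- For `i = 0` the monomial has degree below that of `h`, so the left side is zero by
        -- orthogonality; the right side carries the factor `2i = 0`.
        | zero =>
          rw [gaussFunctional_monomial_mul_harmonic_of_lt _ L m h rfl (by omega) hh]
          simp
        | succ i =>
          rw [ih L.degree (by omega) L m i h rfl (by omega) hh, Nat.add_sub_cancel,
            Nat.factorial_succ]
          push_cast
          field_simp
          ring
      · rw [if_neg hk]
        simp [Finsupp.notMem_support_iff.mp hk]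
    have hsecond : gaussFunctional n (monomial J 1 * pderiv k h) =
        multiFactorial J * coeff J (normSqPoly n ^ i * pderiv k h) / (2 ^ i * i !) := by
      cases m with
      | zero => simp [pderiv_of_isHomogeneous_zero (mem_harmonicSubmodule.mp hh).1]
      | succ m =>
        exact ih J.degree (by omega) J m i _ rfl (by omega) (pderiv_mem_harmonicSubmodule hh k)
    have hcoeff := coeff_pderiv (i := k) (normSqPoly n ^ i * h) J
    rw [pderiv_normSqPoly_pow_mul, coeff_add, add_comm J] at hcoeff
    rw [gaussFunctional_monomial_single_add_mul, hfirst, hsecond, multiFactorial_single_add,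
      ← add_div, ← mul_add, hcoeff]
    push_cast
    ring

end GaussFunctional

/-! ### Harmonic decomposition and dimensions -/

section Decomposition

variable {n : ℕ}

lemma coeff_normSqPoly_single (k : Fin n) :
    coeff (Finsupp.single k 2) (normSqPoly n) = 1 := by
  classical
  rw [normSqPoly, coeff_sum, Finset.sum_eq_single k]
  · simp [coeff_X_pow]
  · intro j _ hj
    simp [coeff_X_pow, Finsupp.single_left_inj, hj]
  · simp

lemma normSqPoly_ne_zero (hn : 1 ≤ n) : normSqPoly n ≠ 0 := by
  intro h
  have := coeff_normSqPoly_single (⟨0, hn⟩ : Fin n)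
  simp [h] at this

/-- Descent in the degree: applying `Δ` to the equation shows that `Δq` satisfies one of the same
form in degree `e - 2`, with the larger constant `c + 2n + 4(e - 2)`. Positivity of the constant is
preserved and forces `q = 0` at the end. -/
lemma eq_zero_of_normSqPoly_mul_laplacian (hn : 1 ≤ n) (e : ℕ) :
    ∀ (q : MvPolynomial (Fin n) ℝ) (c : ℝ), 0 < c → q.IsHomogeneous e →
      normSqPoly n * laplacian n q = (-c) • q → q = 0 := by
  induction e using Nat.strong_induction_on with
  | _ e ih =>
    intro q c hc hq h
    have hc0 : c ≠ 0 := hc.ne'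
    by_cases he : e < 2
    · have hΔ : laplacian n q = 0 := by
        rw [laplacian_apply]
        refine Finset.sum_eq_zero fun k _ => pderiv_of_isHomogeneous_zero ?_ k
        have := hq.pderiv (i := k)
        rwa [show e - 1 = 0 by omega] at this
      rw [hΔ, mul_zero] at h
      exact (smul_eq_zero.mp h.symm).resolve_left (neg_ne_zero.mpr hc0)
    · set q₁ := laplacian n q with hq₁
      have hq₁h : q₁.IsHomogeneous (e - 2) := laplacian_isHomogeneous hq
      have h2 := congrArg (laplacian n) h
      rw [laplacian_normSqPoly_mul hq₁h, map_smul, ← hq₁] at h2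
      have hz : q₁ = 0 := by
        refine ih (e - 2) (by omega) q₁ (c + (2 * n + 4 * (e - 2 : ℕ))) (by positivity) hq₁h ?_
        rw [neg_add, add_smul, ← h2, neg_smul]
        abel
      rw [hz, mul_zero] at h
      exact (smul_eq_zero.mp h.symm).resolve_left (neg_ne_zero.mpr hc0)

/-- Homogeneous polynomials of degree `d` and their coefficient vectors. -/
noncomputable def homogeneousEquiv (n d : ℕ) :
    homogeneousSubmodule (Fin n) ℝ d ≃ₗ[ℝ] (MultiIndex n d → ℝ) where
  toFun f I := coeff I.1 f.1
  map_add' f g := by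
    ext
    simp
  map_smul' c f := by
    ext
    simp
  invFun a := ⟨∑ I, monomial I.1 (a I), Submodule.sum_mem _ fun I _ => isHomogeneous_monomial _ I.2⟩
  left_inv f := by
    classical
    ext K
    simp only [coeff_sum, coeff_monomial]
    by_cases hK : K.degree = d
    · rw [Finset.sum_eq_single ⟨K, hK⟩]
      · simp
      · intro I _ hI
        exact if_neg fun h => hI (Subtype.ext h)
      · simp
    · rw [Finset.sum_eq_zero fun I _ => if_neg fun h => hK (by rw [← h, I.2])]
      exact (f.2.coeff_eq_zero hK).symm
  right_inv a := by
    classical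
    ext J
    simp only [coeff_sum, coeff_monomial]
    rw [Finset.sum_eq_single J]
    · simp
    · intro I _ hI
      exact if_neg fun h => hI (Subtype.ext h)
    · simp

lemma homogeneousEquiv_apply {d : ℕ} (f : homogeneousSubmodule (Fin n) ℝ d)
    (I : MultiIndex n d) : homogeneousEquiv n d f I = coeff I.1 f.1 := rfl

instance (n d : ℕ) : FiniteDimensional ℝ (homogeneousSubmodule (Fin n) ℝ d) :=
  (homogeneousEquiv n d).symm.finiteDimensional

/-- The composition of multiplication by `‖x‖²` and the Laplacian, on homogeneous polynomials. -/
noncomputable def laplacianNormSq (n e : ℕ) : Module.End ℝ (homogeneousSubmodule (Fin n) ℝ e) :=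
  ((laplacian n) ∘ₗ LinearMap.mulLeft ℝ (normSqPoly n)).restrict fun q hq => by
    rw [mem_homogeneousSubmodule] at hq ⊢
    have := laplacian_isHomogeneous (normSqPoly_isHomogeneous.mul hq)
    rwa [Nat.add_sub_cancel_left] at this

/-- In finite dimension injectivity suffices, and a kernel element satisfies `‖x‖² Δq = -(2n + 4e)
q`. -/
lemma laplacianNormSq_surjective (hn : 1 ≤ n) (e : ℕ) :
    Function.Surjective (laplacianNormSq n e) := by
  rw [← LinearMap.injective_iff_surjective, injective_iff_map_eq_zero]
  intro q hq
  have h : laplacian n (normSqPoly n * q.1) = 0 := congrArg Subtype.val hq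
  have hq1 := (mem_homogeneousSubmodule _ _).mp q.2
  rw [laplacian_normSqPoly_mul hq1] at h
  refine Subtype.ext (eq_zero_of_normSqPoly_mul_laplacian hn e q.1 (2 * n + 4 * e) ?_ hq1 ?_)
  · have : (1 : ℝ) ≤ n := by exact_mod_cast hn
    positivity
  · rw [neg_smul]
    exact eq_neg_of_add_eq_zero_right h

lemma exists_laplacian_normSqPoly_mul_eq (hn : 1 ≤ n) {e : ℕ} {p : MvPolynomial (Fin n) ℝ}
    (hp : p.IsHomogeneous e) :
    ∃ q : MvPolynomial (Fin n) ℝ, q.IsHomogeneous e ∧ laplacian n (normSqPoly n * q) = p := by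
  obtain ⟨q, hq⟩ := laplacianNormSq_surjective hn e ⟨p, hp⟩
  exact ⟨q.1, q.2, congrArg Subtype.val hq⟩

/-- The Laplacian as a map between spaces of homogeneous polynomials. -/
noncomputable def laplacianHomogeneous (n e : ℕ) :
    homogeneousSubmodule (Fin n) ℝ (e + 2) →ₗ[ℝ] homogeneousSubmodule (Fin n) ℝ e :=
  (laplacian n).restrict fun q hq => by
    rw [mem_homogeneousSubmodule] at hq ⊢
    exact laplacian_isHomogeneous hq

lemma harmonicSubmodule_eq_map_ker (n e : ℕ) :
    harmonicSubmodule n (e + 2) = (LinearMap.ker (laplacianHomogeneous n e)).map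
      (homogeneousSubmodule (Fin n) ℝ (e + 2)).subtype := by
  ext p
  simp only [mem_harmonicSubmodule, Submodule.mem_map, LinearMap.mem_ker, Submodule.subtype_apply,
    Subtype.exists, mem_homogeneousSubmodule, exists_and_right, exists_eq_right]
  constructor
  · rintro ⟨h1, h2⟩
    exact ⟨h1, Subtype.ext h2⟩
  · rintro ⟨h1, h2⟩
    exact ⟨h1, congrArg Subtype.val h2⟩

lemma finrank_harmonicSubmodule_add (hn : 1 ≤ n) (e : ℕ) :
    Module.finrank ℝ (harmonicSubmodule n (e + 2)) +
      Module.finrank ℝ (homogeneousSubmodule (Fin n) ℝ e) =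
        Module.finrank ℝ (homogeneousSubmodule (Fin n) ℝ (e + 2)) := by
  have hsurj : LinearMap.range (laplacianHomogeneous n e) = ⊤ := by
    rw [LinearMap.range_eq_top]
    intro p
    obtain ⟨q, hq, h⟩ := exists_laplacian_normSqPoly_mul_eq hn p.2
    refine ⟨⟨normSqPoly n * q, ?_⟩, Subtype.ext h⟩
    rw [mem_homogeneousSubmodule, add_comm]
    exact normSqPoly_isHomogeneous.mul hq
  have h := LinearMap.finrank_range_add_finrank_ker (laplacianHomogeneous n e)
  rw [hsurj, finrank_top] at h
  rw [harmonicSubmodule_eq_map_ker, Submodule.finrank_map_subtype_eq, ← h, add_comm]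

lemma harmonicSubmodule_eq_of_lt_two {m : ℕ} (hm : m < 2) :
    harmonicSubmodule n m = homogeneousSubmodule (Fin n) ℝ m := by
  ext p
  rw [mem_harmonicSubmodule, mem_homogeneousSubmodule, and_iff_left_iff_imp]
  intro hp
  rw [laplacian_apply]
  refine Finset.sum_eq_zero fun k _ => pderiv_of_isHomogeneous_zero ?_ k
  have := hp.pderiv (i := k)
  rwa [show m - 1 = 0 by omega] at this

lemma normHarmonic_le (d i : ℕ) (hi : 2 * i ≤ d) :
    normHarmonic n d i ≤ homogeneousSubmodule (Fin n) ℝ d := by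
  rintro _ ⟨h, hh, rfl⟩
  have := (normSqPoly_isHomogeneous.pow i).mul (mem_harmonicSubmodule.mp hh).1
  rw [mem_homogeneousSubmodule]
  rwa [show 2 * i + (d - 2 * i) = d by omega] at this

/-- Choose `q` with `Δ(‖x‖² q) = Δp`. Then `p - ‖x‖² q` is harmonic and `q`, of degree two less, is
decomposed by induction. -/
lemma homogeneousSubmodule_le_iSup_normHarmonic (hn : 1 ≤ n) (d : ℕ) :
    homogeneousSubmodule (Fin n) ℝ d ≤ ⨆ i : {i : ℕ // 2 * i ≤ d}, normHarmonic n d i := by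
  induction d using Nat.strong_induction_on with
  | _ d ih =>
    have h0 : harmonicSubmodule n d ≤ ⨆ i : {i : ℕ // 2 * i ≤ d}, normHarmonic n d i := by
      refine le_trans (fun h hh => ?_) (le_iSup _ ⟨0, by omega⟩)
      exact ⟨h, by simpa using hh, by simp⟩
    by_cases hd : d < 2
    · rwa [← harmonicSubmodule_eq_of_lt_two hd]
    obtain ⟨e, rfl⟩ : ∃ e, d = e + 2 := ⟨d - 2, by omega⟩
    intro p hp
    obtain ⟨q, hq, hqp⟩ := exists_laplacian_normSqPoly_mul_eq hn (laplacian_isHomogeneous hp)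
    have hq2 : (normSqPoly n * q).IsHomogeneous (e + 2) := by
      rw [add_comm]
      exact normSqPoly_isHomogeneous.mul hq
    rw [← sub_add_cancel p (normSqPoly n * q)]
    refine Submodule.add_mem _ (h0 ?_) ?_
    · rw [mem_harmonicSubmodule, map_sub, hqp, sub_self]
      exact ⟨IsHomogeneous.sub hp hq2, rfl⟩
    · have hmap : (⨆ i : {i : ℕ // 2 * i ≤ e}, normHarmonic n e i).map
          (LinearMap.mulLeft ℝ (normSqPoly n)) ≤
            ⨆ i : {i : ℕ // 2 * i ≤ e + 2}, normHarmonic n (e + 2) i := by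
        rw [Submodule.map_iSup]
        refine iSup_le fun i => le_trans ?_ (le_iSup _ ⟨i.1 + 1, by have := i.2; omega⟩)
        rintro _ ⟨_, ⟨h, hh, rfl⟩, rfl⟩
        refine ⟨h, ?_, ?_⟩
        · rwa [show e + 2 - 2 * (i.1 + 1) = e - 2 * i.1 by omega]
        · simp [pow_succ']
      exact hmap ⟨q, ih e (by omega) hq, rfl⟩

lemma finrank_homogeneousSubmodule (n d : ℕ) :
    Module.finrank ℝ (homogeneousSubmodule (Fin n) ℝ d) = n.multichoose d := by
  rw [(homogeneousEquiv n d).finrank_eq, Module.finrank_fintype_fun_eq_card,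
    Fintype.card_of_subtype (Finset.finsuppAntidiag (Finset.univ : Finset (Fin n)) d) fun I => by
      simp [Finset.mem_finsuppAntidiag, Finsupp.degree_eq_sum],
    Finset.card_finsuppAntidiag_nat_eq_multichoose]
  simp

lemma multichoose_eq_choose_sub_one (hn : 1 ≤ n) (m : ℕ) :
    n.multichoose m = (n + m - 1).choose (n - 1) := by
  rw [Nat.multichoose_eq]
  exact Nat.choose_symm_of_eq_add (by omega)

lemma finrank_harmonicSubmodule (hn : 1 ≤ n) (m : ℕ) :
    (Module.finrank ℝ (harmonicSubmodule n m) : ℤ) =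
      binom ((n : ℤ) + m - 1) (n - 1) - binom ((n : ℤ) + m - 3) (n - 1) := by
  have h1 : binom ((n : ℤ) + m - 1) (n - 1) = n.multichoose m := by
    rw [binom, if_pos (by omega), multichoose_eq_choose_sub_one hn]
    congr 2
    omega
  rw [h1]
  by_cases hm : m < 2
  · have h2 : binom ((n : ℤ) + m - 3) (n - 1) = 0 := by
      rw [binom]
      split_ifs with h
      · rw [Nat.choose_eq_zero_of_lt (by omega), Nat.cast_zero]
      · rfl
    rw [h2, harmonicSubmodule_eq_of_lt_two hm, finrank_homogeneousSubmodule, sub_zero]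
  · obtain ⟨e, rfl⟩ : ∃ e, m = e + 2 := ⟨m - 2, by omega⟩
    have h2 : binom ((n : ℤ) + (e + 2 : ℕ) - 3) (n - 1) = n.multichoose e := by
      rw [binom, if_pos (by omega), multichoose_eq_choose_sub_one hn]
      congr 2
      omega
    have h3 := finrank_harmonicSubmodule_add hn e
    rw [finrank_homogeneousSubmodule, finrank_homogeneousSubmodule] at h3
    rw [h2]
    omega

lemma finrank_normHarmonic (hn : 1 ≤ n) (d i : ℕ) :
    Module.finrank ℝ (normHarmonic n d i) =
      Module.finrank ℝ (harmonicSubmodule n (d - 2 * i)) := by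
  rw [normHarmonic]
  refine (Submodule.equivMapOfInjective _ ?_ _).finrank_eq.symm
  exact fun p q h => mul_left_cancel₀ (pow_ne_zero i (normSqPoly_ne_zero hn)) h

end Decomposition

/-! ### The numbers `η_i` are distinct -/

section Eta

lemma eta_of_lt (n : ℕ) {d i : ℕ} (R : ℝ) (h : 2 * i < d) :
    eta n d R i = R ^ (2 * d) * ((n : ℝ) / (n + 2 * d)) *
      (1 / (2 ^ i * (i ! : ℝ) * ∏ j ∈ Finset.range (d - i), ((n : ℝ) + 2 * j))) :=
  if_pos h

/-- Puts the exceptional value in the form produced by the covariance: a second-moment term minus a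
squared mean. It rests on `n/(n+2d) - (n/(n+d))² = n d² / ((n+2d)(n+d)²)`. -/
lemma eta_half {n : ℕ} (hn : 1 ≤ n) (k : ℕ) (R : ℝ) :
    eta n (2 * k) R k = R ^ (2 * (2 * k)) *
      (1 / (2 ^ k * (k ! : ℝ) * ∏ j ∈ Finset.range k, ((n : ℝ) + 2 * j))) *
        (n / (n + 2 * (2 * k : ℕ)) - (n / (n + (2 * k : ℕ))) ^ 2) := by
  have hn' : (0 : ℝ) < n := by exact_mod_cast hn
  have hP : (0 : ℝ) < ∏ j ∈ Finset.range k, ((n : ℝ) + 2 * j) :=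
    Finset.prod_pos fun j _ => by positivity
  have hprod : (n : ℝ) * ∏ j ∈ Finset.range k, (((2 * k : ℕ) : ℝ) + n - 2 * j) =
      (∏ j ∈ Finset.range k, ((n : ℝ) + 2 * j)) * (n + 2 * k) := by
    rw [← Finset.prod_range_succ (fun j : ℕ => (n : ℝ) + 2 * j), Finset.prod_range_succ',
      ← Finset.prod_range_reflect, mul_comm]
    congr 1
    · refine Finset.prod_congr rfl fun j hj => ?_
      have hj' := Finset.mem_range.mp hj
      rw [Nat.sub_sub, Nat.cast_sub (by omega)]
      push_cast
      ring
    · simp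
  rw [eta, if_neg (lt_irrefl _), show 2 * k / 2 = k by omega]
  set Q := ∏ j ∈ Finset.range k, (((2 * k : ℕ) : ℝ) + n - 2 * j)
  have hQ : Q = (∏ j ∈ Finset.range k, ((n : ℝ) + 2 * j)) * (n + 2 * k) / n := by
    rw [← hprod]
    field_simp
  rw [hQ]
  push_cast
  field_simp
  ring

/-- Up to a common factor `η_i` is `a i` for `2i < d`, and `a` increases since `a (i+1) / a i = (n +
2(d-i-1)) / (2(i+1)) > 1`. For `d = 2(k+1)` the last value corresponds to `a k · d/(n+d)`: it is
below `a k`, and above `a (k-1)` when `k ≥ 1`. -/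
lemma eta_ne_of_lt {n : ℕ} (hn : 1 ≤ n) {d i j : ℕ} {R : ℝ} (hR : 0 < R) (hij : i < j)
    (hj : 2 * j ≤ d) : eta n d R i ≠ eta n d R j := by
  have hn' : (0 : ℝ) < n := by exact_mod_cast hn
  set a : ℕ → ℝ := fun i => 1 / (2 ^ i * (i ! : ℝ) * ∏ j ∈ Finset.range (d - i), ((n : ℝ) + 2 * j))
    with ha
  have hP : ∀ s, (0 : ℝ) < ∏ j ∈ Finset.range s, ((n : ℝ) + 2 * j) := fun s =>
    Finset.prod_pos fun j _ => by positivity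
  have apos : ∀ i, 0 < a i := fun i => by
    have := hP (d - i)
    simp only [ha]
    positivity
  have arec : ∀ i s, d = i + 1 + s → a i * (n + 2 * s) = a (i + 1) * (2 * (i + 1)) := by
    intro i s hs
    have := hP s
    simp only [ha]
    rw [show d - i = s + 1 by omega, show d - (i + 1) = s by omega, Finset.prod_range_succ,
      Nat.factorial_succ]
    push_cast
    field_simp
    ring
  have amono : ∀ i s, 2 * (i + s) ≤ d → a i ≤ a (i + s) := by
    intro i s
    induction s with
    | zero => intro _; rfl
    | succ s ih =>
      intro h
      refine (ih (by omega)).trans ?_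
      obtain ⟨t, ht⟩ : ∃ t, d = i + s + 1 + t := ⟨d - (i + s + 1), by omega⟩
      have hr := arec (i + s) t ht
      have hle : (2 * ((i + s : ℕ) + 1) : ℝ) ≤ n + 2 * t := by
        have : 2 * (i + s + 1) ≤ n + 2 * t := by omega
        exact_mod_cast this
      have hpos : (0 : ℝ) < 2 * ((i + s : ℕ) + 1) := by positivity
      have := mul_le_mul_of_nonneg_left hle (apos (i + s)).le
      rw [hr] at this
      exact le_of_mul_le_mul_right this hpos
  have hC : (0 : ℝ) < R ^ (2 * d) * ((n : ℝ) / (n + 2 * d)) := by positivity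
  have hi : eta n d R i = R ^ (2 * d) * ((n : ℝ) / (n + 2 * d)) * a i :=
    eta_of_lt n R (by omega)
  rcases hj.lt_or_eq with hjd | hjd
  · rw [hi, eta_of_lt n R hjd]
    refine (mul_lt_mul_of_pos_left ?_ hC).ne
    change a i < a j
    obtain ⟨s, rfl⟩ : ∃ s, j = i + s + 1 := ⟨j - i - 1, by omega⟩
    refine (amono i s (by omega)).trans_lt ?_
    obtain ⟨t, ht⟩ : ∃ t, d = i + s + 1 + t := ⟨d - (i + s + 1), by omega⟩
    have hr := arec (i + s) t ht
    have hlt : (2 * ((i + s : ℕ) + 1) : ℝ) < n + 2 * t := by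
      have : 2 * (i + s + 1) < n + 2 * t := by omega
      exact_mod_cast this
    have hpos : (0 : ℝ) < 2 * ((i + s : ℕ) + 1) := by positivity
    have := mul_lt_mul_of_pos_left hlt (apos (i + s))
    rw [hr] at this
    exact lt_of_mul_lt_mul_right this hpos.le
  · obtain ⟨k, rfl⟩ : ∃ k, j = k + 1 := ⟨j - 1, by omega⟩
    subst hjd
    have hrk := arec k (k + 1) (by ring)
    have hη : eta n (2 * (k + 1)) R (k + 1) =
        R ^ (2 * (2 * (k + 1))) * ((n : ℝ) / (n + 2 * (2 * (k + 1) : ℕ))) *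
          (a k * (2 * (k + 1)) / (n + 2 * (k + 1))) := by
      have hak : a k = a (k + 1) * (2 * (k + 1)) / (n + 2 * (k + 1)) := by
        rw [eq_div_iff (by positivity), ← hrk]
        push_cast
        ring
      rw [eta_half hn, hak]
      simp only [ha]
      rw [show 2 * (k + 1) - (k + 1) = k + 1 by omega]
      have := hP (k + 1)
      push_cast
      field_simp
      ring
    rw [hi, hη]
    refine fun h => ?_
    have h' := mul_left_cancel₀ hC.ne' h
    rw [eq_div_iff (by positivity)] at h'
    rcases Nat.lt_succ_iff_lt_or_eq.mp hij with hik | rfl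
    · obtain ⟨l, rfl⟩ : ∃ l, k = l + 1 := ⟨k - 1, by omega⟩
      have hrl := arec l (l + 3) (by ring)
      obtain ⟨s, rfl⟩ : ∃ s, l = i + s := ⟨l - i, by omega⟩
      have hm := amono i s (by omega)
      have hp := apos (i + s)
      push_cast at h' hrl hm hp
      set x : ℝ := (i : ℝ) + s
      have hx : 0 ≤ x := by positivity
      have h1 : a (i + s + 1) = a (i + s) * (n + 2 * (x + 3)) / (2 * (x + 1)) := by
        rw [hrl]
        field_simp
      rw [h1] at h'
      have h2 : a i * (n + 2 * (x + 1 + 1)) ≤ a (i + s) * (n + 2 * (x + 1 + 1)) :=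
        mul_le_mul_of_nonneg_right hm (by positivity)
      rw [h', div_mul_eq_mul_div, div_le_iff₀ (by positivity)] at h2
      -- After division by `a (i+s) > 0` this would say `(n + 2x + 6)(x + 2) ≤ (n + 2x + 4)(x + 1)`,
      -- which is absurd.
      have h3 : a (i + s) * (((n : ℝ) + 2 * (x + 3)) * (2 * (x + 1 + 1))) ≤
          a (i + s) * ((n + 2 * (x + 1 + 1)) * (2 * (x + 1))) := by linarith
      have h4 := le_of_mul_le_mul_left h3 hp
      nlinarith
    · have := mul_left_cancel₀ (apos i).ne' h'
      linarith

lemma eta_injective {n : ℕ} (hn : 1 ≤ n) (d : ℕ) {R : ℝ} (hR : 0 < R) :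
    Function.Injective fun i : {i : ℕ // 2 * i ≤ d} => eta n d R i := by
  intro i j h
  by_contra hne
  rcases lt_or_gt_of_ne (fun h' => hne (Subtype.ext h') : i.1 ≠ j.1) with hlt | hlt
  · exact eta_ne_of_lt hn hR hlt j.2 h
  · exact eta_ne_of_lt hn hR hlt i.2 h.symm

end Eta

/-! ### Action of the covariance operator on `‖x‖^{2i} ℋ_{d-2i}` -/

section Eigen

variable {n : ℕ}

lemma matrixOperator_eq_conj {d : ℕ} (M : Matrix (MultiIndex n d) (MultiIndex n d) ℝ) :
    matrixOperator M = (homogeneousEquiv n d).symm.conj (Matrix.toLin' M) := rfl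

lemma charpoly_matrixOperator {d : ℕ} (M : Matrix (MultiIndex n d) (MultiIndex n d) ℝ) :
    (matrixOperator M).charpoly = M.charpoly := by
  rw [matrixOperator_eq_conj, LinearEquiv.charpoly_conj, Matrix.charpoly_toLin']

lemma coeff_matrixOperator {d : ℕ} (M : Matrix (MultiIndex n d) (MultiIndex n d) ℝ)
    (f : homogeneousSubmodule (Fin n) ℝ d) (I : MultiIndex n d) :
    coeff I.1 (matrixOperator M f).1 = ∑ J, M I J * coeff J.1 f.1 :=
  congrFun ((homogeneousEquiv n d).apply_symm_apply
    (fun I => ∑ J, M I J * coeff J.1 f.1)) I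

lemma gaussFunctional_monomial_mul_homogeneous {d : ℕ} (I : Fin n →₀ ℕ)
    (f : homogeneousSubmodule (Fin n) ℝ d) :
    gaussFunctional n (monomial I 1 * f.1) =
      ∑ J : MultiIndex n d, gaussWeight (I + J.1) * coeff J.1 f.1 := by
  have hf : f.1 = ∑ J : MultiIndex n d, monomial J.1 (coeff J.1 f.1) :=
    (congrArg Subtype.val ((homogeneousEquiv n d).symm_apply_apply f)).symm
  conv_lhs => rw [hf]
  rw [Finset.mul_sum, map_sum]
  refine Finset.sum_congr rfl fun J _ => ?_
  rw [monomial_mul, one_mul, gaussFunctional_monomial, mul_comm]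

lemma coeff_matrixOperator_covMatrixTilde (hn : 1 ≤ n) {d : ℕ} {R : ℝ} (hR : 0 < R)
    (f : homogeneousSubmodule (Fin n) ℝ d) (I : MultiIndex n d) :
    coeff I.1 (matrixOperator (covMatrixTilde (uniformBall n R) d) f).1 =
      (ballConst n R (2 * d) * gaussFunctional n (monomial I.1 1 * f.1) -
        ballConst n R d ^ 2 * gaussWeight I.1 * gaussFunctional n f.1) / multiFactorial I.1 := by
  have h0 := gaussFunctional_monomial_mul_homogeneous 0 f
  rw [monomial_zero', C_1, one_mul] at h0
  rw [coeff_matrixOperator, gaussFunctional_monomial_mul_homogeneous, h0, Finset.mul_sum,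
    Finset.mul_sum, ← Finset.sum_sub_distrib, Finset.sum_div]
  refine Finset.sum_congr rfl fun J _ => ?_
  rw [covMatrixTilde, covMatrix, integral_uniformBall_monomialFun hn _ hR,
    integral_uniformBall_monomialFun hn _ hR, integral_uniformBall_monomialFun hn _ hR, map_add,
    I.2, J.2, ← two_mul, zero_add]
  ring

/-- The case `h = 1` of `gaussFunctional_monomial_mul_harmonic`; it makes the rank-one term a
multiple of `‖x‖^{2k}`. -/
lemma gaussWeight_eq_coeff {k : ℕ} (I : MultiIndex n (2 * k)) :
    gaussWeight I.1 =
      multiFactorial I.1 * coeff I.1 (normSqPoly n ^ k) / (2 ^ k * k !) := by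
  have h1 : (1 : MvPolynomial (Fin n) ℝ) ∈ harmonicSubmodule n 0 := by
    rw [harmonicSubmodule_eq_of_lt_two (by norm_num), mem_homogeneousSubmodule]
    exact isHomogeneous_one _ _
  have := gaussFunctional_monomial_mul_harmonic _ I.1 0 k 1 rfl (by rw [I.2]; ring) h1
  rwa [mul_one, mul_one, gaussFunctional_monomial, one_mul] at this

/-- The second factor is the one gained from `‖x‖^{2i}` under the Gaussian expectation; it cancels
the tail of the denominator of `ballConst`. -/
lemma prod_range_split (n d i : ℕ) (hi : i ≤ d) :
    ∏ j ∈ Finset.range d, ((n : ℝ) + 2 * j) =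
      (∏ j ∈ Finset.range (d - i), ((n : ℝ) + 2 * j)) *
        ∏ j ∈ Finset.range i, ((n : ℝ) + (2 * (d - i) : ℕ) + 2 * j) := by
  obtain ⟨s, rfl⟩ := Nat.exists_eq_add_of_le' hi
  rw [Finset.prod_range_add, Nat.add_sub_cancel]
  congr 1
  refine Finset.prod_congr rfl fun j _ => ?_
  push_cast
  ring

lemma matrixOperator_covMatrixTilde_normHarmonic (hn : 1 ≤ n) {d i : ℕ} (hi : 2 * i ≤ d) {R : ℝ}
    (hR : 0 < R) (f : homogeneousSubmodule (Fin n) ℝ d) (hf : f.1 ∈ normHarmonic n d i) :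
    matrixOperator (covMatrixTilde (uniformBall n R) d) f = eta n d R i • f := by
  have hn' : (0 : ℝ) < n := by exact_mod_cast hn
  have hP : ∀ s, (0 : ℝ) < ∏ j ∈ Finset.range s, ((n : ℝ) + 2 * j) := fun s =>
    Finset.prod_pos fun j _ => by positivity
  apply (homogeneousEquiv n d).injective
  ext I
  rw [homogeneousEquiv_apply, homogeneousEquiv_apply, coeff_matrixOperator_covMatrixTilde hn hR,
    Submodule.coe_smul, coeff_smul, smul_eq_mul]
  obtain ⟨h, hh, hfh⟩ := hf
  rw [LinearMap.mulLeft_apply] at hfh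
  have hI := multiFactorial_pos I.1
  have hfirst : gaussFunctional n (monomial I.1 1 * f.1) =
      (∏ j ∈ Finset.range i, ((n : ℝ) + (2 * (d - i) : ℕ) + 2 * j)) *
        (multiFactorial I.1 * coeff I.1 f.1 / (2 ^ i * i !)) := by
    have hhom := (isHomogeneous_monomial (1 : ℝ) I.2).mul (mem_harmonicSubmodule.mp hh).1
    rw [show d + (d - 2 * i) = 2 * (d - i) by omega] at hhom
    rw [← hfh, mul_left_comm, gaussFunctional_normSqPoly_pow_mul hhom,
      gaussFunctional_monomial_mul_harmonic d I.1 (d - 2 * i) i h I.2 (by omega) hh]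
  have hconst : ballConst n R (2 * d) =
      R ^ (2 * d) * (n / (n + 2 * d)) / ∏ j ∈ Finset.range d, ((n : ℝ) + 2 * j) := by
    rw [ballConst, Nat.mul_div_cancel_left _ two_pos]
    push_cast
    rfl
  have hsplit := prod_range_split n d i (by omega)
  have hQ : (0 : ℝ) < ∏ j ∈ Finset.range i, ((n : ℝ) + (2 * (d - i) : ℕ) + 2 * j) :=
    Finset.prod_pos fun j _ => by positivity
  have hPi := hP (d - i)
  rw [hfirst, hconst, hsplit]
  rcases hi.lt_or_eq with hid | hid
  -- Here `h` has positive degree, so `f` has mean zero and the rank-one term drops out.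
  · have hG : gaussFunctional n f.1 = 0 := by
      rw [← hfh, gaussFunctional_normSqPoly_pow_mul (mem_harmonicSubmodule.mp hh).1,
        gaussFunctional_harmonic (by omega) hh, mul_zero]
    rw [hG, eta_of_lt n R hid]
    field_simp
    ring
  · subst hid
    -- Here `h` is a constant and `f` is that constant times `‖x‖^d`, so the rank-one term
    -- contributes the squared mean in `eta_half`.
    have h0 := (mem_harmonicSubmodule.mp hh).1
    rw [Nat.sub_self, ← totalDegree_zero_iff_isHomogeneous, totalDegree_eq_zero_iff_eq_C] at h0
    have hfc : f.1 = coeff 0 h • normSqPoly n ^ i := by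
      rw [← hfh, smul_eq_C_mul, mul_comm, ← h0]
    have hG : gaussFunctional n f.1 =
        (∏ j ∈ Finset.range i, ((n : ℝ) + 2 * j)) * coeff 0 h := by
      have h1 := gaussFunctional_normSqPoly_pow_mul (isHomogeneous_one (Fin n) ℝ) i
      rw [mul_one, ← C_1, ← monomial_zero', gaussFunctional_monomial, gaussWeight_zero] at h1
      rw [hfc, map_smul, h1]
      simp [mul_comm]
    have hb : ballConst n R (2 * i) =
        R ^ (2 * i) * (n / (n + (2 * i : ℕ))) / ∏ j ∈ Finset.range i, ((n : ℝ) + 2 * j) := by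
      rw [ballConst, Nat.mul_div_cancel_left _ two_pos]
    have hc : coeff I.1 f.1 = coeff 0 h * coeff I.1 (normSqPoly n ^ i) := by
      rw [hfc, coeff_smul, smul_eq_mul]
    rw [show 2 * i - i = i by omega] at hQ hPi ⊢
    rw [hG, gaussWeight_eq_coeff, hb, eta_half hn, hc]
    push_cast at hQ ⊢
    field_simp
    ring

end Eigen

/-! ### From spanning subspaces of eigenspaces to equality and semisimplicity -/

section General

/-- Modular law: the join of the other `N j` meets `E i` trivially, so intersecting the
decomposition of `⊤` with `E i` leaves only `N i`. -/
lemma eq_of_iSupIndep_of_iSup_eq_top {α ι : Type*} [CompleteLattice α] [IsModularLattice α]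
    {N E : ι → α} (hE : iSupIndep E) (hle : N ≤ E) (htop : ⨆ i, N i = ⊤) : N = E := by
  refine funext fun i => (hle i).antisymm ?_
  have hN : N i ⊔ ⨆ (j) (_ : j ≠ i), N j = ⊤ := by
    rw [eq_top_iff, ← htop]
    refine iSup_le fun j => ?_
    by_cases hj : j = i
    · exact hj ▸ le_sup_left
    · exact le_sup_of_le_right (le_iSup₂_of_le j hj le_rfl)
  have hdisj : (⨆ (j) (_ : j ≠ i), N j) ⊓ E i = ⊥ := by
    rw [← disjoint_iff]
    exact (hE i).symm.mono_left (iSup₂_mono fun j _ => hle j)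
  calc E i = (N i ⊔ ⨆ (j) (_ : j ≠ i), N j) ⊓ E i := by rw [hN, top_inf_eq]
    _ = N i ⊔ (⨆ (j) (_ : j ≠ i), N j) ⊓ E i := (sup_inf_assoc_of_le _ (hle i)).symm ▸ rfl
    _ = N i := by rw [hdisj, sup_bot_eq]
    _ ≤ N i := le_rfl

/-- The product of the `X - c i` kills every eigenspace, hence annihilates `T`; it is squarefree
because the `c i` are distinct. -/
lemma isSemisimple_of_iSup_eigenspace_eq_top {K V ι : Type*} [Field K] [AddCommGroup V]
    [Module K V] [FiniteDimensional K V] [Fintype ι] (T : Module.End K V) (c : ι → K)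
    (hc : Function.Injective c) (h : ⨆ i, T.eigenspace (c i) = ⊤) : T.IsSemisimple := by
  refine Module.End.isSemisimple_of_squarefree_aeval_eq_zero
    (p := ∏ i, (Polynomial.X - Polynomial.C (c i)))
    (Polynomial.separable_prod_X_sub_C_iff.mpr hc).squarefree ?_
  rw [← LinearMap.ker_eq_top, eq_top_iff, ← h]
  classical
  refine iSup_le fun i x hx => ?_
  rw [LinearMap.mem_ker, ← Finset.prod_erase_mul _ _ (Finset.mem_univ i), map_mul,
    Module.End.mul_apply]
  have : (Polynomial.aeval T (Polynomial.X - Polynomial.C (c i))) x = 0 := by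
    rw [Module.End.mem_eigenspace_iff] at hx
    simp [hx]
  rw [this, map_zero]

end General

/-! ### Eigenspaces and multiplicities -/

section Main

variable {n : ℕ}

lemma iSup_comap_normHarmonic (hn : 1 ≤ n) (d : ℕ) :
    ⨆ i : {i : ℕ // 2 * i ≤ d},
      (normHarmonic n d i).comap (homogeneousSubmodule (Fin n) ℝ d).subtype = ⊤ := by
  apply Submodule.map_injective_of_injective
    (homogeneousSubmodule (Fin n) ℝ d).injective_subtype
  rw [Submodule.map_iSup, Submodule.map_subtype_top]
  simp_rw [Submodule.map_comap_subtype]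
  refine le_antisymm (iSup_le fun i => inf_le_left) ?_
  refine (homogeneousSubmodule_le_iSup_normHarmonic hn d).trans (iSup_mono fun i => ?_)
  exact le_inf (normHarmonic_le d i i.2) le_rfl

lemma comap_normHarmonic_eq_eigenspace (hn : 1 ≤ n) (d : ℕ) {R : ℝ} (hR : 0 < R) :
    (fun i : {i : ℕ // 2 * i ≤ d} =>
      (normHarmonic n d i).comap (homogeneousSubmodule (Fin n) ℝ d).subtype) =
      fun i : {i : ℕ // 2 * i ≤ d} =>
        (matrixOperator (covMatrixTilde (uniformBall n R) d)).eigenspace (eta n d R i) := by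
  refine eq_of_iSupIndep_of_iSup_eq_top
    ((Module.End.eigenspaces_iSupIndep _).comp (eta_injective hn d hR)) ?_ ?_
  · intro i f hf
    exact Module.End.mem_eigenspace_iff.mpr
      (matrixOperator_covMatrixTilde_normHarmonic hn i.2 hR f hf)
  · exact iSup_comap_normHarmonic hn d

lemma isSemisimple_matrixOperator_covMatrixTilde (hn : 1 ≤ n) (d : ℕ) {R : ℝ} (hR : 0 < R) :
    (matrixOperator (covMatrixTilde (uniformBall n R) d)).IsSemisimple := by
  have : Finite {i : ℕ // 2 * i ≤ d} :=
    (Set.finite_Iic d).subset fun i (hi : 2 * i ≤ d) => show i ≤ d by omega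
  have := Fintype.ofFinite {i : ℕ // 2 * i ≤ d}
  refine isSemisimple_of_iSup_eigenspace_eq_top _ _ (eta_injective hn d hR) ?_
  have h := comap_normHarmonic_eq_eigenspace hn d hR
  rw [← iSup_congr (congrFun h)]
  exact iSup_comap_normHarmonic hn d

lemma map_eigenspace_eq_normHarmonic (hn : 1 ≤ n) {d i : ℕ} (hi : 2 * i ≤ d) {R : ℝ}
    (hR : 0 < R) :
    ((matrixOperator (covMatrixTilde (uniformBall n R) d)).eigenspace (eta n d R i)).map
      (homogeneousSubmodule (Fin n) ℝ d).subtype = normHarmonic n d i := by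
  rw [← congrFun (comap_normHarmonic_eq_eigenspace hn d hR) ⟨i, hi⟩,
    Submodule.map_comap_subtype, inf_eq_right]
  exact normHarmonic_le d i hi

lemma finrank_eigenspace_eq (hn : 1 ≤ n) {d i : ℕ} (hi : 2 * i ≤ d) {R : ℝ} (hR : 0 < R) :
    Module.finrank ℝ
      ((matrixOperator (covMatrixTilde (uniformBall n R) d)).eigenspace (eta n d R i)) =
        Module.finrank ℝ (harmonicSubmodule n (d - 2 * i)) := by
  rw [← Submodule.finrank_map_subtype_eq, map_eigenspace_eq_normHarmonic hn hi hR,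
    finrank_normHarmonic hn]

end Main

end BallCovariance

theorem mainTheorem5 (n d : ℕ) (hn : 1 ≤ n) (R : ℝ) (hR : 0 < R)
    (hiso : BallCovariance.IsIsotropic (BallCovariance.uniformBall n R))
    (i : ℕ) (hi : 2 * i ≤ d) :
    (Module.End.eigenspace (BallCovariance.matrixOperator
        (BallCovariance.covMatrixTilde (BallCovariance.uniformBall n R) d))
        (BallCovariance.eta n d R i)).map (MvPolynomial.homogeneousSubmodule (Fin n) ℝ d).subtype
      = BallCovariance.normHarmonic n d i ∧
    Module.finrank ℝ (Module.End.eigenspace (BallCovariance.matrixOperator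
        (BallCovariance.covMatrixTilde (BallCovariance.uniformBall n R) d))
        (BallCovariance.eta n d R i))
      = Module.finrank ℝ (BallCovariance.harmonicSubmodule n (d - 2 * i)) ∧
    (BallCovariance.covMatrixTilde (BallCovariance.uniformBall n R) d).charpoly.rootMultiplicity
        (BallCovariance.eta n d R i)
      = Module.finrank ℝ (BallCovariance.harmonicSubmodule n (d - 2 * i)) ∧
    (Module.finrank ℝ (BallCovariance.harmonicSubmodule n (d - 2 * i)) : ℤ)
      = BallCovariance.binom ((n : ℤ) + d - 2 * i - 1) (n - 1)
        - BallCovariance.binom ((n : ℤ) + d - 2 * i - 3) (n - 1) := by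
  refine ⟨BallCovariance.map_eigenspace_eq_normHarmonic hn hi hR,
    BallCovariance.finrank_eigenspace_eq hn hi hR, ?_, ?_⟩
  -- The root multiplicity is the dimension of the generalized eigenspace, which semisimplicity
  -- reduces to the eigenspace.
  · rw [← BallCovariance.charpoly_matrixOperator, ← LinearMap.finrank_maxGenEigenspace_eq,
      (BallCovariance.isSemisimple_matrixOperator_covMatrixTilde hn d
        hR).isFinitelySemisimple.maxGenEigenspace_eq_eigenspace,
      BallCovariance.finrank_eigenspace_eq hn hi hR]
  · rw [BallCovariance.finrank_harmonicSubmodule hn]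
    congr 2 <;> omega
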